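/- Let $\mathbf x=(x_i)_{i\in I}$ and $\mathbf y=(y_j)_{j\in J}$ be two disjoint sets of indeterminates, and let $t\in\mathbb N=\{0,1,2,\dots\}$. Let $a_n^{(i)}=a_n^{(i)}(\mathbf x)\in\mathbb R[\mathbf x]$ ($0\le i\le 2$, $n\ge 0$) and $b_n=b_n(\mathbf y)\in\mathbb R[\mathbf y]$ ($n\ge0$) be polynomials with nonnegative coefficients. For $n,k\ge 0$ consider the lattice paths in $\mathbb N^2$ from $(0,0)$ to $(k,n)$ with steps $(0,1)$ and $(1,t+i)$ for $0\le i\le 2$, where a step $(0,1)$ starting at height $m-1$ (and so ending at height $m$) has weight $b_m$, and a step $(1,t+i)$ starting at height $m-t-i$ (and so ending at height $m$) has weight $a_m^{(i)}$. The weight of a path is the product of the weights of its steps. Let $M=[M_{n,k}]_{n,k\ge0}$ be the matrix whose entry $M_{n,k}$ is the sum of the weights of all lattice paths from $(0,0)$ to $(k,n)$. An infinite matrix with entries in $\mathbb R[\mathbf x,\mathbf y]$ is called $(\mathbf x,\mathbf y)$-totally positive if all its (finite) minors are polynomials with nonnegative coefficients. The Toeplitz matrix of a sequence $(s_k)_{k\ge0}$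 is $[s_{i-j}]_{i,j\ge0}$, where $s_k=0$ for $k<0$. Suppose that at least one of the following four conditions holds: (i) $a_1^{(1)}=a_1^{(0)}$, and $a_n^{(1)}=a_n^{(0)}+a_n^{(2)}$ for all $n\ge2$; (ii) $a_1^{(1)}=a_2^{(2)}$, and $a_n^{(1)}=a_{n-1}^{(0)}+a_{n+1}^{(2)}$ for all $n\ge2$; (iii) $a_1^{(1)}=1$, and $a_n^{(1)}=a_{n-1}^{(0)}a_n^{(2)}+1$ for all $n\ge2$; (iv) $a_1^{(1)}=a_1^{(0)}a_2^{(2)}$, and $a_n^{(1)}=a_n^{(0)}a_{n+1}^{(2)}+1$ for all $n\ge2$. Then the matrix $M$ is $(\mathbf x,\mathbf y)$-totally positive; and if $t\ge1$, then for every $n\ge0$ the Toeplitz matrix of the row sequence $(M_{n,k})_{k\ge0}$ is $(\mathbf x,\mathbf y)$-totally positive. -/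

import Mathlib

/-- The steps of the lattice paths: `up` is the step `(0,1)`, and `right i` is the step `(1, t + i)`,
for `0 ≤ i ≤ ℓ`. -/
inductive LatticeStep (ℓ : ℕ) : Type
  | up : LatticeStep ℓ
  | right (i : Fin (ℓ + 1)) : LatticeStep ℓ

namespace LatticeStep

/-- The displacement in `ℕ × ℕ` of a step; the first coordinate is horizontal, the second one is
the height. -/
def vec {ℓ : ℕ} (t : ℕ) : LatticeStep ℓ → ℕ × ℕ
  | up => (0, 1)
  | right i => (1, t + (i : ℕ))

/-- Steps inject into `Option (Fin (ℓ + 1))`. -/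
def toOption {ℓ : ℕ} : LatticeStep ℓ → Option (Fin (ℓ + 1))
  | up => none
  | right i => some i

instance instFinite {ℓ : ℕ} : Finite (LatticeStep ℓ) := by
  refine Finite.of_injective (toOption (ℓ := ℓ)) ?_
  rintro (_ | i) (_ | j) h <;> simp_all [toOption]

end LatticeStep

/-- The set of lattice paths from `(0,0)` to `(k,n)` with steps `(0,1)` and `(1,t+i)`,
`0 ≤ i ≤ ℓ`. A path is recorded by the list of its steps, in order. -/
def latticePaths (t ℓ n k : ℕ) : Set (List (LatticeStep ℓ)) :=
  {p | (p.map (LatticeStep.vec t)).sum = (k, n)}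

/-- A path has at most as many steps as the sum of the coordinates of its end point. -/
theorem length_le_of_sum_vec {ℓ : ℕ} (t : ℕ) (p : List (LatticeStep ℓ)) :
    p.length ≤ (p.map (LatticeStep.vec t)).sum.1 + (p.map (LatticeStep.vec t)).sum.2 := by
  induction p with
  | nil => simp
  | cons s p ih =>
    cases s <;> simp [LatticeStep.vec] <;> omega

theorem latticePaths_finite (t ℓ n k : ℕ) : (latticePaths t ℓ n k).Finite := by
  refine (List.finite_length_le (LatticeStep ℓ) (k + n)).subset ?_
  intro p hp
  have h := length_le_of_sum_vec t p
  have hp' : (p.map (LatticeStep.vec t)).sum = (k, n) := hp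
  rw [hp'] at h
  exact h

section Matrices

variable {R : Type*} [CommRing R]

/-- The weight of a path that starts at height `h`: the product of the weights of its steps, where
a step `(0,1)` that ends at height `m` (that is, starts at height `m - 1`) has weight `b m`, and a
step `(1,t+i)` that ends at height `m` (that is, starts at height `m - t - i`) has weight
`a i m`. -/
def pathWeight {ℓ : ℕ} (t : ℕ) (a : Fin (ℓ + 1) → ℕ → R) (b : ℕ → R) :
    ℕ → List (LatticeStep ℓ) → R
  | _, [] => 1
  | h, LatticeStep.up :: p => b (h + 1) * pathWeight t a b (h + 1) p
  | h, LatticeStep.right i :: p =>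
      a i (h + (t + (i : ℕ))) * pathWeight t a b (h + (t + (i : ℕ))) p

/-- The infinite matrix whose `(n,k)` entry is the sum of the weights of all lattice paths from
`(0,0)` to `(k,n)`. -/
noncomputable def pathMatrix (t ℓ : ℕ) (a : Fin (ℓ + 1) → ℕ → R) (b : ℕ → R) : Matrix ℕ ℕ R :=
  Matrix.of fun n k => ∑ p ∈ (latticePaths_finite t ℓ n k).toFinset, pathWeight t a b 0 p

/-- The Toeplitz matrix `[s (i - j)]` of a sequence, where `s` is zero at negative indices. -/
def toeplitzMatrix (s : ℕ → R) : Matrix ℕ ℕ R :=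
  Matrix.of fun i j => if j ≤ i then s (i - j) else 0

end Matrices

/-- A real polynomial in a set of indeterminates all of whose coefficients are nonnegative. -/
def NonnegCoeffs {σ : Type*} (p : MvPolynomial σ ℝ) : Prop :=
  ∀ m : σ →₀ ℕ, 0 ≤ p.coeff m

/-- A matrix of real polynomials is totally positive in the indeterminates if every minor is a
polynomial with nonnegative coefficients. -/
def IsPolyTotallyPositive {σ : Type*} (A : Matrix ℕ ℕ (MvPolynomial σ ℝ)) : Prop :=
  ∀ (m : ℕ) (r c : Fin m → ℕ), StrictMono r → StrictMono c →
    NonnegCoeffs (A.submatrix r c).det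

/-- The path matrix over `ℝ[x,y]` with weights `a_n^{(i)}(x) = a i n` and `b_n(y) = b n`; the two
families of indeterminates are indexed by `σ` and by `τ`. -/
noncomputable def weightedPathMatrix {σ τ : Type*} (t ℓ : ℕ)
    (a : Fin (ℓ + 1) → ℕ → MvPolynomial σ ℝ) (b : ℕ → MvPolynomial τ ℝ) :
    Matrix ℕ ℕ (MvPolynomial (σ ⊕ τ) ℝ) :=
  pathMatrix t ℓ (fun i n => MvPolynomial.rename Sum.inl (a i n))
    (fun n => MvPolynomial.rename Sum.inr (b n))

/-! Removing the last step of a path gives (1 - B) M = [e₀ | L S M]: B carries the up weights on its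
subdiagonal, L is lower triangular with the right weights on three bands, and S shifts rows down by
t. Each of the four conditions factors L into two lower bidiagonal matrices with coefficientwise
nonnegative entries. Column k + 1 of the right side involves only column k of M, so induction on the
number of columns applies: row selection, bidiagonal factors, prepending e₀ and inverting 1 - B all
keep minors in a subsemiring (`minorsIn_of_column_recurrence`).

The Toeplitz claim comes from the same argument for `extendByShifts`: each row below row N is its
predecessor shifted right, a recurrence of the same shape with B zero and L the identity there. Its
rows from N on form the transposed Toeplitz matrix of row N; its rows up to N, for N large, give the
minors of M. -/

/-! ### Operations preserving minors in a subsemiring -/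

section Minors

variable {R : Type*} [CommRing R] (P : Subsemiring R)

/-- All minors of `A` on columns with index less than `K` lie in the subsemiring `P`. -/
def MinorsIn (K : ℕ) (A : Matrix ℕ ℕ R) : Prop :=
  ∀ (m : ℕ) (r c : Fin m → ℕ), StrictMono r → StrictMono c → (∀ i, c i < K) →
    (A.submatrix r c).det ∈ P

variable {P}

theorem MinorsIn.of_monotone {K : ℕ} {A : Matrix ℕ ℕ R} (hA : MinorsIn P K A) {m : ℕ}
    {r c : Fin m → ℕ} (hr : Monotone r) (hc : StrictMono c) (hK : ∀ i, c i < K) :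
    (A.submatrix r c).det ∈ P := by
  by_cases hinj : Function.Injective r
  · exact hA m r c (hr.strictMono_of_injective hinj) hc hK
  · simp only [Function.Injective, not_forall] at hinj
    obtain ⟨i, j, hij, hne⟩ := hinj
    rw [Matrix.det_zero_of_row_eq hne (by ext k; simp [hij])]
    exact P.zero_mem

/-- The product of a lower bidiagonal matrix, with diagonal `d` and subdiagonal `e`, and `A`. -/
def bidiagonalMul (d e : ℕ → R) (A : Matrix ℕ ℕ R) : Matrix ℕ ℕ R :=
  Matrix.of fun n k => d n * A n k + e n * A (n - 1) k

/-- Expanding the determinant multilinearly in its rows picks row `r i` or `r i - 1` for each `i`.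
As `r` is strictly increasing, every such choice is weakly increasing, so each term is a product of
entries of the factor with a minor of `A` or with zero. -/
theorem MinorsIn.bidiagonalMul {K : ℕ} {A : Matrix ℕ ℕ R} (hA : MinorsIn P K A) {d e : ℕ → R}
    (hd : ∀ n, d n ∈ P) (he : ∀ n, e n ∈ P) : MinorsIn P K (bidiagonalMul d e A) := by
  classical
  intro m r c hr hc hK
  have key : ((_root_.bidiagonalMul d e A).submatrix r c).det =
      Matrix.detRowAlternating ((fun i => d (r i) • fun j => A (r i) (c j)) +
        (fun i => e (r i) • fun j => A (r i - 1) (c j))) := rfl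
  rw [key, ← AlternatingMap.coe_multilinearMap, MultilinearMap.map_add_univ]
  refine P.sum_mem fun s _ => ?_
  have hs : s.piecewise (fun i => d (r i) • fun j => A (r i) (c j))
        (fun i => e (r i) • fun j => A (r i - 1) (c j)) =
      fun i => (if i ∈ s then d (r i) else e (r i)) •
        fun j => A (if i ∈ s then r i else r i - 1) (c j) := by
    funext i
    by_cases hi : i ∈ s
    · simp only [Finset.piecewise, hi, if_true]
    · simp only [Finset.piecewise, hi, if_false]
  rw [hs, MultilinearMap.map_smul_univ, smul_eq_mul]
  refine P.mul_mem (P.prod_mem fun i _ => ?_) ?_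
  · split_ifs
    exacts [hd _, he _]
  · refine hA.of_monotone (r := fun i => if i ∈ s then r i else r i - 1) ?_ hc hK
    intro i j hij
    rcases hij.eq_or_lt with rfl | hlt
    · exact le_rfl
    · have := hr hlt
      dsimp only
      split_ifs <;> omega

/-- Solving `(1 - B) G = A` for `G`, where `B` has only the subdiagonal `b`, preserves `MinorsIn`. -/
theorem MinorsIn.of_recurrence {K : ℕ} {A G : Matrix ℕ ℕ R} (hA : MinorsIn P K A) {b : ℕ → R}
    (hb : ∀ n, b n ∈ P) (h0 : ∀ k, k < K → G 0 k = A 0 k)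
    (hG : ∀ n k, k < K → G (n + 1) k = b (n + 1) * G n k + A (n + 1) k) : MinorsIn P K G := by
  have stage : ∀ j, MinorsIn P K (Matrix.of fun n k => if n ≤ j then G n k else A n k) := by
    intro j
    induction j with
    | zero =>
      intro m r c hr hc hK
      convert hA m r c hr hc hK using 2
      ext i k
      by_cases h : r i = 0
      · simp [h, h0 _ (hK k)]
      · simp [h]
    | succ j ih =>
      -- An elementary factor adds b_{j+1} times row j, already a row of `G`, to row j + 1. The
      -- inverse of 1 - B is the infinite product of these factors.
      have hL := ih.bidiagonalMul (d := fun _ => 1) (e := fun n => if n = j + 1 then b n else 0)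
        (fun _ => P.one_mem) (fun n => by split_ifs; exacts [hb _, P.zero_mem])
      intro m r c hr hc hK
      convert hL m r c hr hc hK using 2
      ext i k
      simp only [Matrix.submatrix_apply, Matrix.of_apply, _root_.bidiagonalMul]
      rcases lt_trichotomy (r i) (j + 1) with h | h | h
      · simp [h.le, Nat.lt_succ_iff.mp h, h.ne]
      · simp [h, hG _ _ (hK k), add_comm]
      · simp [show ¬ r i ≤ j + 1 by omega, show ¬ r i ≤ j by omega, h.ne']
  intro m r c hr hc hK
  -- A minor sees finitely many rows; the sum bounds all their indices.
  convert stage (∑ i, r i) m r c hr hc hK using 2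
  ext i k
  simp [Finset.single_le_sum (f := r) (fun _ _ => Nat.zero_le _) (Finset.mem_univ i)]

/-- Selecting rows in a weakly increasing way, preceded by `z` zero rows. -/
def selectRows (z : ℕ) (ρ : ℕ → ℕ) (A : Matrix ℕ ℕ R) : Matrix ℕ ℕ R :=
  Matrix.of fun n k => if n < z then 0 else A (ρ n) k

theorem MinorsIn.selectRows {K : ℕ} {A : Matrix ℕ ℕ R} (hA : MinorsIn P K A) (z : ℕ) {ρ : ℕ → ℕ}
    (hρ : Monotone ρ) : MinorsIn P K (selectRows z ρ A) := by
  intro m r c hr hc hK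
  by_cases h : ∃ i, r i < z
  · obtain ⟨i, hi⟩ := h
    rw [Matrix.det_eq_zero_of_row_eq_zero i (by intro j; simp [_root_.selectRows, hi])]
    exact P.zero_mem
  · push Not at h
    convert hA.of_monotone (hρ.comp hr.monotone) hc hK using 2
    ext i k
    simp [_root_.selectRows, (h i).not_gt]

/-- The matrix whose column `0` is the first unit vector, followed by the columns of `A`. -/
def consUnitColumn (A : Matrix ℕ ℕ R) : Matrix ℕ ℕ R :=
  Matrix.of fun n k => if k = 0 then (if n = 0 then 1 else 0) else A n (k - 1)

theorem MinorsIn.consUnitColumn {K : ℕ} {A : Matrix ℕ ℕ R} (hA : MinorsIn P K A) :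
    MinorsIn P (K + 1) (consUnitColumn A) := by
  intro m r c hr hc hK
  have shift : ∀ {l : ℕ} (r' c' : Fin l → ℕ), StrictMono r' → StrictMono c' →
      (∀ i, 0 < c' i) → (∀ i, c' i < K + 1) →
      ((_root_.consUnitColumn A).submatrix r' c').det ∈ P := by
    intro l r' c' hr' hc' hpos hK'
    convert hA l r' (fun i => c' i - 1) hr' ?_ ?_ using 2
    · ext i k
      simp [_root_.consUnitColumn, (hpos k).ne']
    · intro i j hij
      have := hc' hij
      have := hpos i
      dsimp only
      omega
    · intro i
      have := hpos i
      have := hK' i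
      omega
  cases m with
  | zero => simp [P.one_mem]
  | succ m =>
    by_cases hc0 : c 0 = 0
    · by_cases hr0 : r 0 = 0
      · have hrpos : ∀ i : Fin m, r i.succ ≠ 0 := fun i => by
          have := hr (Fin.succ_pos i)
          omega
        -- The only nonzero entry of this column is in the top left corner, so its cofactor has sign
        -- +1.
        rw [Matrix.det_succ_column_zero, Fin.sum_univ_succ]
        simp only [Matrix.submatrix_apply, Matrix.submatrix_submatrix, hc0]
        rw [Finset.sum_eq_zero fun i _ => by simp [_root_.consUnitColumn, hrpos]]
        simp only [_root_.consUnitColumn, Matrix.of_apply, hr0, if_true, Fin.val_zero, pow_zero,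
          one_mul, add_zero]
        refine shift _ _ (hr.comp (Fin.strictMono_succAbove 0))
          (hc.comp (Fin.strictMono_succ)) (fun i => ?_) (fun i => hK _)
        have := hc (Fin.succ_pos i)
        simp only [Function.comp]
        omega
      · rw [Matrix.det_eq_zero_of_column_eq_zero 0]
        · exact P.zero_mem
        · intro i
          have := hr.monotone (Fin.zero_le i)
          simp [_root_.consUnitColumn, hc0, show r i ≠ 0 by omega]
    · refine shift r c hr hc (fun i => ?_) hK
      have := hc.monotone (Fin.zero_le i)
      omega

/-- A matrix `F` with `(1 - B) F = [e₀ | L₁ L₂ S F]`, where `L₁`, `L₂` are lower bidiagonal, `B` is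
subdiagonal and `S` selects rows, has all its minors in a subsemiring that contains the entries of
`B`, `L₁` and `L₂`. -/
theorem minorsIn_of_column_recurrence {F : Matrix ℕ ℕ R} {d₁ e₁ d₂ e₂ b : ℕ → R}
    (hd₁ : ∀ n, d₁ n ∈ P) (he₁ : ∀ n, e₁ n ∈ P) (hd₂ : ∀ n, d₂ n ∈ P) (he₂ : ∀ n, e₂ n ∈ P)
    (hb : ∀ n, b n ∈ P) (z : ℕ) {ρ : ℕ → ℕ} (hρ : Monotone ρ)
    (h0 : ∀ k, F 0 k =
      consUnitColumn (bidiagonalMul d₁ e₁ (bidiagonalMul d₂ e₂ (selectRows z ρ F))) 0 k)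
    (hF : ∀ n k, F (n + 1) k = b (n + 1) * F n k +
      consUnitColumn (bidiagonalMul d₁ e₁ (bidiagonalMul d₂ e₂ (selectRows z ρ F))) (n + 1) k)
    (K : ℕ) : MinorsIn P K F := by
  induction K with
  | zero =>
    intro m r c _ _ hK
    cases m with
    | zero => simp [P.one_mem]
    | succ m => exact absurd (hK 0) (Nat.not_lt_zero _)
  | succ K ih =>
    exact ((((ih.selectRows z hρ).bidiagonalMul hd₂ he₂).bidiagonalMul
      hd₁ he₁).consUnitColumn).of_recurrence hb (fun k _ => h0 k) (fun n k _ => hF n k)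

end Minors

/-! ### The last-step recurrence for path weights -/

section Paths

variable {R : Type*} [CommRing R] {ℓ : ℕ}

theorem pathWeight_append_up (t : ℕ) (a : Fin (ℓ + 1) → ℕ → R) (b : ℕ → R)
    (p : List (LatticeStep ℓ)) (h : ℕ) :
    pathWeight t a b h (p ++ [LatticeStep.up]) =
      b (h + (p.map (LatticeStep.vec t)).sum.2 + 1) * pathWeight t a b h p := by
  induction p generalizing h with
  | nil => simp [pathWeight]
  | cons s p ih =>
    cases s <;> simp only [List.cons_append, pathWeight, ih, List.map_cons, List.sum_cons,
      LatticeStep.vec, Prod.snd_add] <;> simp only [add_assoc] <;> ring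

theorem pathWeight_append_right (t : ℕ) (a : Fin (ℓ + 1) → ℕ → R) (b : ℕ → R)
    (p : List (LatticeStep ℓ)) (i : Fin (ℓ + 1)) (h : ℕ) :
    pathWeight t a b h (p ++ [LatticeStep.right i]) =
      a i (h + (p.map (LatticeStep.vec t)).sum.2 + (t + (i : ℕ))) * pathWeight t a b h p := by
  induction p generalizing h with
  | nil => simp [pathWeight]
  | cons s p ih =>
    cases s <;> simp only [List.cons_append, pathWeight, ih, List.map_cons, List.sum_cons,
      LatticeStep.vec, Prod.snd_add] <;> simp only [add_assoc] <;> ring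

/-- The recurrence for the path matrix obtained by removing the last step of a path. -/
theorem pathMatrix_eq (t : ℕ) (a : Fin (ℓ + 1) → ℕ → R) (b : ℕ → R) (n k : ℕ) :
    pathMatrix t ℓ a b n k = (if n = 0 ∧ k = 0 then 1 else 0) +
      ((if 1 ≤ n then b n * pathMatrix t ℓ a b (n - 1) k else 0) +
        ∑ i : Fin (ℓ + 1), if 1 ≤ k ∧ t + (i : ℕ) ≤ n then
          a i n * pathMatrix t ℓ a b (n - (t + i)) (k - 1) else 0) := by
  -- `E`, `U` and `V i` collect the empty path, the paths ending with an up step and those ending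
  -- with `right i`.
  classical
  set E : Finset (List (LatticeStep ℓ)) := if n = 0 ∧ k = 0 then {[]} else ∅ with hE
  set U : Finset (List (LatticeStep ℓ)) := if 1 ≤ n then
    (latticePaths_finite t ℓ (n - 1) k).toFinset.image (· ++ [LatticeStep.up]) else ∅ with hU
  set V : Fin (ℓ + 1) → Finset (List (LatticeStep ℓ)) := fun i => if 1 ≤ k ∧ t + (i : ℕ) ≤ n then
    (latticePaths_finite t ℓ (n - (t + i)) (k - 1)).toFinset.image (· ++ [LatticeStep.right i])
    else ∅ with hV
  have memE : ∀ p, p ∈ E ↔ p = [] ∧ n = 0 ∧ k = 0 := by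
    intro p; rw [hE]; split_ifs with h <;> simp [h]
  have memU : ∀ p, p ∈ U ↔ 1 ≤ n ∧ ∃ q ∈ latticePaths t ℓ (n - 1) k,
      q ++ [LatticeStep.up] = p := by
    intro p; rw [hU]; split_ifs with h <;> simp [h]
  have memV : ∀ i p, p ∈ V i ↔ (1 ≤ k ∧ t + (i : ℕ) ≤ n) ∧
      ∃ q ∈ latticePaths t ℓ (n - (t + i)) (k - 1), q ++ [LatticeStep.right i] = p := by
    intro i p; simp only [hV]; split_ifs with h <;> simp [h]
  have hunion : (latticePaths_finite t ℓ n k).toFinset =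
      E ∪ (U ∪ Finset.univ.biUnion V) := by
    ext p
    simp only [Set.Finite.mem_toFinset, Finset.mem_union, Finset.mem_biUnion, Finset.mem_univ,
      true_and, memE, memU, memV, latticePaths, Set.mem_ofPred_eq]
    rcases List.eq_nil_or_concat p with rfl | ⟨q, s, rfl⟩
    · simp only [List.map_nil, List.sum_nil, Prod.ext_iff, Prod.fst_zero, Prod.snd_zero,
        true_and, List.append_eq_nil_iff, List.cons_ne_self, and_false, exists_false,
        or_false]
      constructor <;> rintro ⟨h1, h2⟩ <;> exact ⟨by omega, by omega⟩
    · cases s with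
      | up =>
        simp only [List.concat_eq_append, List.append_eq_nil_iff, List.map_append, List.map_cons,
          List.map_nil, List.sum_append, List.sum_singleton, LatticeStep.vec, Prod.ext_iff,
          Prod.fst_add, Prod.snd_add, List.append_cancel_right_eq]
        constructor
        · rintro ⟨h1, h2⟩
          exact Or.inr (Or.inl ⟨by omega, q, ⟨by omega, by omega⟩, rfl⟩)
        · rintro (⟨⟨_, h⟩, _⟩ | ⟨h1, q', ⟨h2, h3⟩, h4⟩ | ⟨i, _, q', _, h4⟩)
          · simp at h
          · subst h4
            omega
          · simpa using (List.append_inj' h4 rfl).2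
      | right i =>
        simp only [List.concat_eq_append, List.append_eq_nil_iff, List.map_append, List.map_cons,
          List.map_nil, List.sum_append, List.sum_singleton, LatticeStep.vec, Prod.ext_iff,
          Prod.fst_add, Prod.snd_add]
        constructor
        · rintro ⟨h1, h2⟩
          exact Or.inr (Or.inr ⟨i, by omega, q, ⟨by omega, by omega⟩, rfl⟩)
        · rintro (⟨⟨_, h⟩, _⟩ | ⟨h1, q', ⟨h2, h3⟩, h4⟩ | ⟨i', h1, q', ⟨h2, h3⟩, h4⟩)
          · simp at h
          · simpa using (List.append_inj' h4 rfl).2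
          · obtain ⟨rfl, h5⟩ := List.append_inj' h4 rfl
            simp only [List.cons.injEq, LatticeStep.right.injEq, and_true] at h5
            subst h5
            omega
  have hVdisj : Set.PairwiseDisjoint (↑(Finset.univ : Finset (Fin (ℓ + 1)))) V := by
    intro i _ j _ hij
    rw [Function.onFun, Finset.disjoint_left]
    intro p hp hq
    obtain ⟨_, q, _, rfl⟩ := (memV i p).1 hp
    obtain ⟨_, q', _, h⟩ := (memV j _).1 hq
    have := (List.append_inj' h rfl).2
    simp only [List.cons.injEq, LatticeStep.right.injEq, and_true] at this
    exact hij this.symm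
  have hUV : Disjoint U (Finset.univ.biUnion V) := by
    rw [Finset.disjoint_left]
    intro p hp hq
    obtain ⟨_, q, _, rfl⟩ := (memU p).1 hp
    obtain ⟨i, _, hi⟩ := Finset.mem_biUnion.1 hq
    obtain ⟨_, q', _, h⟩ := (memV i _).1 hi
    simpa using (List.append_inj' h rfl).2
  have hEUV : Disjoint E (U ∪ Finset.univ.biUnion V) := by
    rw [Finset.disjoint_left]
    intro p hp hq
    obtain ⟨rfl, _⟩ := (memE p).1 hp
    rcases Finset.mem_union.1 hq with hq | hq
    · obtain ⟨_, q, _, h⟩ := (memU _).1 hq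
      simp at h
    · obtain ⟨i, _, hi⟩ := Finset.mem_biUnion.1 hq
      obtain ⟨_, q', _, h⟩ := (memV i _).1 hi
      simp at h
  have hinj : ∀ s : LatticeStep ℓ, Function.Injective (· ++ [s]) :=
    fun s => List.append_left_injective [s]
  simp only [pathMatrix, Matrix.of_apply]
  rw [hunion, Finset.sum_union hEUV, Finset.sum_union hUV, Finset.sum_biUnion hVdisj]
  congr 1
  · rw [hE]; split_ifs <;> simp [pathWeight]
  congr 1
  · rw [hU]
    split_ifs with h
    · rw [Finset.sum_image (hinj _).injOn, Finset.mul_sum]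
      refine Finset.sum_congr rfl fun p hp => ?_
      have hp' : (p.map (LatticeStep.vec t)).sum = (k, n - 1) := by simpa [latticePaths] using hp
      rw [pathWeight_append_up, hp']
      simp [Nat.sub_add_cancel h]
    · simp
  · refine Finset.sum_congr rfl fun i _ => ?_
    simp only [hV]
    split_ifs with h
    · rw [Finset.sum_image (hinj _).injOn, Finset.mul_sum]
      refine Finset.sum_congr rfl fun p hp => ?_
      have hp' : (p.map (LatticeStep.vec t)).sum = (k - 1, n - (t + i)) := by
        simpa [latticePaths] using hp
      rw [pathWeight_append_right, hp']
      simp [Nat.sub_add_cancel h.2]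
    · simp

/-! ### Extension by shifts of a row -/

/-- The rows `0, …, N` of `M`, followed by the right shifts of row `N`. -/
def extendByShifts (N : ℕ) (M : Matrix ℕ ℕ R) : Matrix ℕ ℕ R :=
  Matrix.of fun n k => if n ≤ N then M n k else if n - N ≤ k then M N (k - (n - N)) else 0

/-- If the three bands of coefficients of the right steps form a product of two lower bidiagonal
matrices, then the minors of the extended path matrix lie in every subsemiring that contains the
weights of up steps and the entries of the two factors. -/
theorem minorsIn_extendByShifts_pathMatrix {P : Subsemiring R} (t : ℕ)
    (a : Fin (2 + 1) → ℕ → R) {b d₁ e₁ d₂ e₂ : ℕ → R}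
    (hd₁ : ∀ n, d₁ n ∈ P) (he₁ : ∀ n, e₁ n ∈ P) (hd₂ : ∀ n, d₂ n ∈ P) (he₂ : ∀ n, e₂ n ∈ P)
    (hb : ∀ n, b n ∈ P) (he₁0 : e₁ 0 = 0) (he₂0 : e₂ 0 = 0)
    (h0 : ∀ n, a 0 n = d₁ n * d₂ n)
    (h1 : ∀ n, a 1 (n + 1) = d₁ (n + 1) * e₂ (n + 1) + e₁ (n + 1) * d₂ n)
    (h2 : ∀ n, a 2 (n + 2) = e₁ (n + 2) * e₂ (n + 1)) (N K : ℕ) :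
    MinorsIn P K (extendByShifts N (pathMatrix t 2 a b)) := by
  set M := pathMatrix t 2 a b with hM
  have hrec : ∀ n k, M n k = (if n = 0 ∧ k = 0 then 1 else 0) +
      ((if 1 ≤ n then b n * M (n - 1) k else 0) +
        ((if 1 ≤ k ∧ t ≤ n then a 0 n * M (n - t) (k - 1) else 0) +
          (if 1 ≤ k ∧ t + 1 ≤ n then a 1 n * M (n - (t + 1)) (k - 1) else 0) +
          (if 1 ≤ k ∧ t + 2 ≤ n then a 2 n * M (n - (t + 2)) (k - 1) else 0))) := fun n k =>
    (pathMatrix_eq t a b n k).trans (by rw [Fin.sum_univ_three]; rfl)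
  have mem_ite : ∀ (f : ℕ → R) (x : R), (∀ n, f n ∈ P) → x ∈ P →
      ∀ n, (if n ≤ N then f n else x) ∈ P := by
    intro f x hf hx n
    split_ifs
    exacts [hf n, hx]
  have hρ : Monotone fun n => if n ≤ N then n - t else n - 1 := by
    intro i j hij
    dsimp only
    split_ifs <;> omega
  -- Beyond row N both bidiagonal factors act as the identity, and `ρ n = n - 1` with the prepended
  -- column produces the right shift.
  have htail : ∀ n k, N < n → extendByShifts N M n k =
      consUnitColumn (bidiagonalMul (fun n => if n ≤ N then d₁ n else 1)
        (fun n => if n ≤ N then e₁ n else 0)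
        (bidiagonalMul (fun n => if n ≤ N then d₂ n else 1) (fun n => if n ≤ N then e₂ n else 0)
          (selectRows (min t (N + 1)) (fun n => if n ≤ N then n - t else n - 1)
            (extendByShifts N M)))) n k := by
    intro n k hn
    have hn' : ¬ n ≤ N := by omega
    cases k with
    | zero => simp [extendByShifts, consUnitColumn, hn', show n ≠ 0 by omega]
    | succ k =>
      -- Capping t at N + 1 keeps the shifted rows from being zeroed when t is large.
      have hz : ¬ n < min t (N + 1) := by omega
      simp only [consUnitColumn, bidiagonalMul, selectRows, extendByShifts, Matrix.of_apply, hn',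
        if_false, hz, Nat.add_eq_zero_iff, one_ne_zero, and_false, Nat.add_sub_cancel, one_mul,
        zero_mul, add_zero]
      by_cases h : n - 1 ≤ N
      · obtain rfl : n = N + 1 := by omega
        simp
      · simp only [h, if_false]
        by_cases h' : n - N ≤ k + 1
        · rw [if_pos h', if_pos (by omega)]
          congr 1
          omega
        · rw [if_neg h', if_neg (by omega)]
  have hsel : ∀ n k, n ≤ N → selectRows (min t (N + 1))
      (fun n => if n ≤ N then n - t else n - 1) (extendByShifts N M) n k =
        if t ≤ n then M (n - t) k else 0 := by
    intro n k hn
    by_cases h : t ≤ n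
    · simp [selectRows, extendByShifts, hn, h, show n - t ≤ N by omega]
    · rw [selectRows, Matrix.of_apply, if_pos (by omega), if_neg h]
  refine minorsIn_of_column_recurrence
    (d₁ := fun n => if n ≤ N then d₁ n else 1) (e₁ := fun n => if n ≤ N then e₁ n else 0)
    (d₂ := fun n => if n ≤ N then d₂ n else 1) (e₂ := fun n => if n ≤ N then e₂ n else 0)
    (b := fun n => if n ≤ N then b n else 0)
    (mem_ite _ _ hd₁ P.one_mem) (mem_ite _ _ he₁ P.zero_mem) (mem_ite _ _ hd₂ P.one_mem)
    (mem_ite _ _ he₂ P.zero_mem) (mem_ite _ _ hb P.zero_mem) (min t (N + 1)) hρ ?_ ?_ K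
  · intro k
    cases k with
    | zero =>
      simp only [extendByShifts, consUnitColumn, Matrix.of_apply, Nat.zero_le, if_true]
      rw [hrec]
      simp
    | succ k =>
      simp only [consUnitColumn, bidiagonalMul, Matrix.of_apply, hsel _ _ (Nat.zero_le N)]
      simp only [extendByShifts, Matrix.of_apply, Nat.zero_le, if_true]
      rw [hrec]
      simp [he₁0, he₂0, h0, mul_assoc]
  · intro n k
    by_cases hn : n + 1 ≤ N
    swap
    · rw [htail _ _ (by omega)]
      simp [hn]
    have hn' : n ≤ N := by omega
    cases k with
    | zero =>
      simp only [extendByShifts, consUnitColumn, Matrix.of_apply, hn, hn', if_true]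
      rw [hrec]
      simp
    | succ k =>
      simp only [consUnitColumn, bidiagonalMul, Matrix.of_apply, hsel _ _ hn,
        hsel _ _ hn', hsel _ _ ((Nat.sub_le n 1).trans hn'), Nat.add_sub_cancel, hn, hn', if_true,
        Nat.add_eq_zero_iff, one_ne_zero, and_false, if_false]
      simp only [extendByShifts, Matrix.of_apply, hn, hn', if_true]
      rw [hrec]
      have e1 : n + 1 - (t + 1) = n - t := by omega
      simp only [e1, h0, h1,
        Nat.add_sub_cancel, Nat.le_add_left, true_and, Nat.add_eq_zero_iff, one_ne_zero, and_false,
        if_false, if_true, zero_add, Nat.add_le_add_iff_right]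
      -- Row 1 has no second predecessor: truncated subtraction yields row 0 again, and `e₂ 0 = 0`
      -- removes it.
      cases n with
      | zero =>
        simp only [he₂0, zero_mul, add_zero, show ¬ t + 2 ≤ 0 + 1 by omega, if_false]
        split_ifs <;> ring
      | succ n =>
        have e2 : n + 1 + 1 - (t + 2) = n - t := by omega
        simp only [e2, h2, Nat.add_sub_cancel, show t + 2 ≤ n + 1 + 1 ↔ t ≤ n by omega]
        split_ifs <;> ring

end Paths

/-! ### Nonnegative coefficients and the four factorizations -/

/-- The subsemiring of real polynomials with nonnegative coefficients. -/
def nonnegCoeffsSubsemiring (σ : Type*) : Subsemiring (MvPolynomial σ ℝ) where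
  carrier := {p | NonnegCoeffs p}
  zero_mem' := fun m => by simp
  one_mem' := fun m => by
    classical
    rw [MvPolynomial.coeff_one]
    split_ifs <;> norm_num
  add_mem' := fun {p q} hp hq m => by
    rw [MvPolynomial.coeff_add]
    exact add_nonneg (hp m) (hq m)
  mul_mem' := fun {p q} hp hq m => by
    classical
    rw [MvPolynomial.coeff_mul]
    exact Finset.sum_nonneg fun x _ => mul_nonneg (hp _) (hq _)

theorem NonnegCoeffs.rename_mem {σ τ : Type*} (f : σ → τ) {p : MvPolynomial σ ℝ}
    (hp : NonnegCoeffs p) : MvPolynomial.rename f p ∈ nonnegCoeffsSubsemiring τ := by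
  classical
  rw [p.as_sum, map_sum]
  refine Subsemiring.sum_mem _ fun m _ => ?_
  rw [MvPolynomial.rename_monomial]
  intro m'
  rw [MvPolynomial.coeff_monomial]
  split_ifs
  exacts [hp m, le_rfl]

theorem corollary1p6 {σ τ : Type*} (t : ℕ)
    (a : Fin (2 + 1) → ℕ → MvPolynomial σ ℝ) (b : ℕ → MvPolynomial τ ℝ)
    (ha : ∀ i n, NonnegCoeffs (a i n)) (hb : ∀ n, NonnegCoeffs (b n))
    (h :
      (a 1 1 = a 0 1 ∧ ∀ n, 2 ≤ n → a 1 n = a 0 n + a 2 n) ∨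
      (a 1 1 = a 2 2 ∧ ∀ n, 2 ≤ n → a 1 n = a 0 (n - 1) + a 2 (n + 1)) ∨
      (a 1 1 = 1 ∧ ∀ n, 2 ≤ n → a 1 n = a 0 (n - 1) * a 2 n + 1) ∨
      (a 1 1 = a 0 1 * a 2 2 ∧ ∀ n, 2 ≤ n → a 1 n = a 0 n * a 2 (n + 1) + 1)) :
    IsPolyTotallyPositive (weightedPathMatrix t 2 a b) ∧
      (1 ≤ t → ∀ n : ℕ,
        IsPolyTotallyPositive (toeplitzMatrix (fun k => weightedPathMatrix t 2 a b n k))) := by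
  have key : ∀ N K, MinorsIn (nonnegCoeffsSubsemiring (σ ⊕ τ)) K
      (extendByShifts N (weightedPathMatrix t 2 a b)) := by
    set P := nonnegCoeffsSubsemiring (σ ⊕ τ)
    set A : Fin (2 + 1) → ℕ → MvPolynomial (σ ⊕ τ) ℝ :=
      fun i n => MvPolynomial.rename Sum.inl (a i n) with hA
    have hAP : ∀ i n, A i n ∈ P := fun i n => (ha i n).rename_mem _
    have hBP : ∀ n, MvPolynomial.rename Sum.inr (b n) ∈ P := fun n => (hb n).rename_mem _
    -- Below, `e₁` starts at index 2 and `e₂` at index 1. The value `e₁ 1 = 0` drops one summand of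
    -- a_1^{(1)}, which is why each condition treats n = 1 separately.
    have cut : ∀ (l : ℕ) (f : ℕ → MvPolynomial (σ ⊕ τ) ℝ), (∀ n, f n ∈ P) →
        ∀ n, (if n < l then 0 else f n) ∈ P := by
      intro l f hf n
      split_ifs
      exacts [P.zero_mem, hf n]
    have one : ∀ _ : ℕ, (1 : MvPolynomial (σ ⊕ τ) ℝ) ∈ P := fun _ => P.one_mem
    intro N K
    rcases h with ⟨h1, h2⟩ | ⟨h1, h2⟩ | ⟨h1, h2⟩ | ⟨h1, h2⟩
    · refine minorsIn_extendByShifts_pathMatrix t A (d₁ := A 0)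
        (e₁ := fun n => if n < 2 then 0 else A 2 n) (d₂ := fun _ => 1)
        (e₂ := fun n => if n < 1 then 0 else 1)
        (hAP 0) (cut _ _ (hAP 2)) one (cut _ _ one) hBP ?_ ?_ ?_ ?_ ?_ N K
      · simp
      · simp
      · simp
      · rintro (_ | n)
        · simp [hA, h1]
        · simp [hA, h2 (n + 2) (by omega)]
      · simp
    · refine minorsIn_extendByShifts_pathMatrix t A (d₁ := fun _ => 1)
        (e₁ := fun n => if n < 2 then 0 else 1) (d₂ := A 0)
        (e₂ := fun n => if n < 1 then 0 else A 2 (n + 1))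
        one (cut _ _ one) (hAP 0) (cut _ _ fun n => hAP 2 (n + 1)) hBP ?_ ?_ ?_ ?_ ?_ N K
      · simp
      · simp
      · simp
      · rintro (_ | n)
        · simp [hA, h1]
        · simp [hA, h2 (n + 2) (by omega)]
          ring
      · simp
    · refine minorsIn_extendByShifts_pathMatrix t A (d₁ := fun _ => 1)
        (e₁ := fun n => if n < 2 then 0 else A 2 n) (d₂ := A 0)
        (e₂ := fun n => if n < 1 then 0 else 1)
        one (cut _ _ (hAP 2)) (hAP 0) (cut _ _ one) hBP ?_ ?_ ?_ ?_ ?_ N K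
      · simp
      · simp
      · simp
      · rintro (_ | n)
        · simp [hA, h1]
        · simp [hA, h2 (n + 2) (by omega)]
          ring
      · simp
    · refine minorsIn_extendByShifts_pathMatrix t A (d₁ := A 0)
        (e₁ := fun n => if n < 2 then 0 else 1) (d₂ := fun _ => 1)
        (e₂ := fun n => if n < 1 then 0 else A 2 (n + 1))
        (hAP 0) (cut _ _ one) one (cut _ _ fun n => hAP 2 (n + 1)) hBP ?_ ?_ ?_ ?_ ?_ N K
      · simp
      · simp
      · simp
      · rintro (_ | n)
        · simp [hA, h1]
        · simp [hA, h2 (n + 2) (by omega)]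
      · simp
  have le_sum : ∀ {m : ℕ} (f : Fin m → ℕ) (i : Fin m), f i ≤ ∑ j, f j := fun f i =>
    Finset.single_le_sum (fun _ _ => Nat.zero_le _) (Finset.mem_univ i)
  refine ⟨?_, fun _ N => ?_⟩
  · intro m r c hr hc
    have := key (∑ i, r i) (∑ i, c i + 1) m r c hr hc fun i => Nat.lt_succ_of_le (le_sum c i)
    change _ ∈ nonnegCoeffsSubsemiring (σ ⊕ τ)
    convert this using 2
    ext i j : 1
    simp [extendByShifts, le_sum r i]
  · intro m r c hr hc
    -- Row N + c of the extension has entry M_{N, r - c} in column r, so the Toeplitz minor on rows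
    -- `r` and columns `c` appears transposed.
    have := key N (∑ i, r i + 1) m (fun i => N + c i) r (fun i j hij => by simpa using hc hij) hr
      fun i => Nat.lt_succ_of_le (le_sum r i)
    rw [← Matrix.det_transpose] at this
    change _ ∈ nonnegCoeffsSubsemiring (σ ⊕ τ)
    convert this using 2
    ext i j : 1
    -- Row N itself falls under the unshifted branch of `extendByShifts`.
    by_cases hj : c j = 0
    · simp [extendByShifts, toeplitzMatrix, hj]
    · simp [extendByShifts, toeplitzMatrix, hj, add_comm (r i) N]
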